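/- Let $n$ be a natural number, $\hbar>0$ and $\mathcal H=L^2(\mathbb R^n)$. For $1\le j\le n$ let $\hat q_j$ be multiplication by $x_j$ and $\hat p_j=-i\hbar\,\partial/\partial x_j$, each on its maximal domain in $\mathcal H$, and put $\hat\xi=(\hat\xi_1,\dots,\hat\xi_{2n})=(\hat q_1,\hat p_1,\dots,\hat q_n,\hat p_n)$, $\beta=1_{n\times n}\otimes\begin{pmatrix}0&1\\-1&0\end{pmatrix}$ and $Sp(2n,\mathbb R)=\{S\in\mathbb R^{2n\times 2n}: S\beta S^T=\beta\}$. A metaplectic unitary for $S\in Sp(2n,\mathbb R)$ is a unitary operator $\overline U(S)$ on $\mathcal H$ with $\overline U(S)^{-1}\hat\xi_a\overline U(S)=\sum_b S_{ab}\hat\xi_b$ for all $a$ on $D=\bigcap_b \mathrm{dom}\,\hat\xi_b$ (that is, $\overline U(S)D\subseteq D$ and $\hat\xi_a\overline U(S)f=\overline U(S)\sum_bS_{ab}\hat\xi_bf$ for $f\in D$). For a density operator $\hat\rho$ on $\mathcal H$ ($\hat\rho^\dagger=\hat\rho\ge0$, $\mathrm{Tr}\,\hat\rho=1$) with finite second moments,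 i.e. such that $\hat\xi_a\hat\rho^{1/2}$ is everywhere defined and Hilbert–Schmidt for every $a$, put $\langle \hat\xi_a\rangle=\mathrm{Tr}(\hat\rho^{1/2}\,\hat\xi_a\hat\rho^{1/2})$ and $\langle\hat\xi_a\hat\xi_b\rangle=\mathrm{Tr}\big((\hat\xi_a\hat\rho^{1/2})^\dagger(\hat\xi_b\hat\rho^{1/2})\big)$, and let $V=V(\hat\rho)$ be the variance matrix $$V_{ab}=\tfrac12\langle\hat\xi_a\hat\xi_b+\hat\xi_b\hat\xi_a\rangle-\langle\hat\xi_a\rangle\langle\hat\xi_b\rangle .$$ Then every $S\in Sp(2n,\mathbb R)$ has a metaplectic unitary. For every metaplectic unitary $\overline U(S)$ for $S$ and every density operator $\hat\rho$ with finite second moments, $\hat\rho'=\overline U(S)\,\hat\rho\,\overline U(S)^{-1}$ is again a density operator with finite second moments, its variance matrix is $$V'=S\,V\,S^T,$$ and $$V+\tfrac{i\hbar}{2}\beta\ge0\iff V'+\tfrac{i\hbar}{2}\beta\ge0 .$$ -/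

import Mathlib

open MeasureTheory
open scoped ComplexOrder InnerProductSpace SchwartzMap LineDeriv Kronecker

noncomputable section

namespace QuantumModes

/-! ### States and expectation values on a Hilbert space -/

section States

variable {H : Type} [NormedAddCommGroup H] [InnerProductSpace ℂ H] [CompleteSpace H]

/-- `T` is trace class with trace `t`: in every orthonormal basis the diagonal entries of `T` are
(unconditionally) summable, with sum `t`. -/
def HasTrace (T : H →L[ℂ] H) (t : ℂ) : Prop :=
  ∀ (ι : Type) (e : HilbertBasis ι ℂ H), HasSum (fun i => ⟪e i, T (e i)⟫_ℂ) t

/-- Density operators: `ρ† = ρ ≥ 0` and `Tr ρ = 1`. -/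
def IsDensityOperator (ρ : H →L[ℂ] H) : Prop :=
  ρ.IsPositive ∧ HasTrace ρ 1

/-- For symmetric, possibly unbounded, operators `A`, `B`: the expectation value `Tr (ρ A B)`
exists and equals `t`. It is read, as usual for unbounded operators, as the trace of
`(A √ρ)† (B √ρ)`: the range of `√ρ` lies in the domains of `A` and `B`, and
`∑ i, ⟪A √ρ e i, B √ρ e i⟫ = t` in every orthonormal basis `e`.
For `ρ = ∑ λ k |ψ k⟩⟨ψ k|` this is `∑ λ k ⟪A (ψ k), B (ψ k)⟫`. -/
def HasMoment (ρ : H →L[ℂ] H) (A B : H →ₗ.[ℂ] H) (t : ℂ) : Prop :=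
  ∃ (hA : ∀ x, CFC.sqrt ρ x ∈ A.domain) (hB : ∀ x, CFC.sqrt ρ x ∈ B.domain),
    ∀ (ι : Type) (e : HilbertBasis ι ℂ H),
      HasSum (fun i => ⟪A ⟨CFC.sqrt ρ (e i), hA (e i)⟩, B ⟨CFC.sqrt ρ (e i), hB (e i)⟩⟫_ℂ) t

open Classical in
/-- The number `⟨A B⟩ = Tr (ρ A B)` (and `0` if this expectation value does not exist). -/
def moment (ρ : H →L[ℂ] H) (A B : H →ₗ.[ℂ] H) : ℂ :=
  if h : ∃ t, HasMoment ρ A B t then h.choose else 0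

/-- The identity, as an everywhere defined operator. -/
def idOp : H →ₗ.[ℂ] H := ⟨⊤, (⊤ : Submodule ℂ H).subtype⟩

/-- The number `⟨A⟩ = Tr (ρ A)`. -/
def mean (ρ : H →L[ℂ] H) (A : H →ₗ.[ℂ] H) : ℂ := moment ρ idOp A

/-- The covariance `½ ⟨{A, B}⟩ - ⟨A⟩ ⟨B⟩` (a real number for symmetric `A` and `B`). -/
def covariance (ρ : H →L[ℂ] H) (A B : H →ₗ.[ℂ] H) : ℂ :=
  (moment ρ A B + moment ρ B A) / 2 - mean ρ A * mean ρ B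

end States

/-! ### Position and momentum operators -/

/-- Configuration space `ℝⁿ`. -/
abbrev Config (n : ℕ) : Type := EuclideanSpace ℝ (Fin n)

/-- The Hilbert space `L²(ℝⁿ)`. -/
abbrev Hilb (n : ℕ) : Type := Lp ℂ 2 (volume : Measure (Config n))

theorem coord_mul_add {n : ℕ} (j : Fin n) (f g : Hilb n) :
    (fun x : Config n => (x j : ℂ) * (f + g : Hilb n) x) =ᵐ[volume]
      (fun x : Config n => (x j : ℂ) * f x) + fun x : Config n => (x j : ℂ) * g x := by
  filter_upwards [Lp.coeFn_add f g] with x hx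
  rw [hx, Pi.add_apply, Pi.add_apply, mul_add]

theorem coord_mul_smul {n : ℕ} (j : Fin n) (c : ℂ) (f : Hilb n) :
    (fun x : Config n => (x j : ℂ) * (c • f : Hilb n) x) =ᵐ[volume]
      c • fun x : Config n => (x j : ℂ) * f x := by
  filter_upwards [Lp.coeFn_smul c f] with x hx
  rw [hx, Pi.smul_apply, Pi.smul_apply, smul_eq_mul, smul_eq_mul, mul_left_comm]

/-- The maximal domain of multiplication by the `j`-th coordinate. -/
def positionDomain {n : ℕ} (j : Fin n) : Submodule ℂ (Hilb n) where
  carrier := {f | MemLp (fun x : Config n => (x j : ℂ) * f x) 2 volume}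
  zero_mem' := by
    have h := coord_mul_smul j 0 (0 : Hilb n)
    rw [zero_smul, zero_smul] at h
    exact (memLp_congr_ae h).mpr MemLp.zero
  add_mem' := by
    intro f g hf hg
    exact (memLp_congr_ae (coord_mul_add j f g)).mpr (MemLp.add hf hg)
  smul_mem' := by
    intro c f hf
    exact (memLp_congr_ae (coord_mul_smul j c f)).mpr (MemLp.const_smul hf c)

theorem memLp_coord_mul {n : ℕ} {j : Fin n} (f : positionDomain j) :
    MemLp (fun x : Config n => (x j : ℂ) * (f : Hilb n) x) 2 volume :=
  f.2

/-- The position operator: multiplication by the `j`-th coordinate on its maximal domain. -/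
def position {n : ℕ} (j : Fin n) : Hilb n →ₗ.[ℂ] Hilb n where
  domain := positionDomain j
  toFun :=
    { toFun := fun f => (memLp_coord_mul f).toLp
      map_add' := by
        intro f g
        rw [← MemLp.toLp_add (memLp_coord_mul f) (memLp_coord_mul g)]
        exact MemLp.toLp_congr _ _ (coord_mul_add j f.1 g.1)
      map_smul' := by
        intro c f
        rw [RingHom.id_apply, ← MemLp.toLp_const_smul c (memLp_coord_mul f)]
        exact MemLp.toLp_congr _ _ (coord_mul_smul j c f.1) }

/-- `g` is the weak (distributional) derivative `∂f/∂x_j`, for `f`, `g` in `L²(ℝⁿ)`. -/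
def IsWeakDeriv {n : ℕ} (j : Fin n) (f g : Hilb n) : Prop :=
  ∀ φ : 𝓢(Config n, ℂ),
    ∫ x, f x * (∂_{EuclideanSpace.single j (1 : ℝ)} φ) x = -∫ x, g x * φ x

theorem integrable_mul_schwartz {n : ℕ} (f : Hilb n) (φ : 𝓢(Config n, ℂ)) :
    Integrable (fun x => f x * φ x) :=
  MemLp.integrable_mul (Lp.memLp f) (φ.memLp 2)

theorem IsWeakDeriv.add {n : ℕ} {j : Fin n} {f g f' g' : Hilb n}
    (h : IsWeakDeriv j f g) (h' : IsWeakDeriv j f' g') : IsWeakDeriv j (f + f') (g + g') := by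
  have key : ∀ (u v : Hilb n) (ψ : 𝓢(Config n, ℂ)),
      ∫ x, (u + v : Hilb n) x * ψ x = (∫ x, u x * ψ x) + ∫ x, v x * ψ x := by
    intro u v ψ
    rw [← integral_add (integrable_mul_schwartz u ψ) (integrable_mul_schwartz v ψ)]
    refine integral_congr_ae ?_
    filter_upwards [Lp.coeFn_add u v] with x hx
    rw [hx, Pi.add_apply, add_mul]
  intro φ
  rw [key, key, h φ, h' φ]
  ring

theorem IsWeakDeriv.smul {n : ℕ} {j : Fin n} {f g : Hilb n} (c : ℂ)
    (h : IsWeakDeriv j f g) : IsWeakDeriv j (c • f) (c • g) := by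
  have key : ∀ (u : Hilb n) (ψ : 𝓢(Config n, ℂ)),
      ∫ x, (c • u : Hilb n) x * ψ x = c * ∫ x, u x * ψ x := by
    intro u ψ
    rw [← integral_const_mul]
    refine integral_congr_ae ?_
    filter_upwards [Lp.coeFn_smul c u] with x hx
    rw [hx, Pi.smul_apply, smul_eq_mul, mul_assoc]
  intro φ
  rw [key, key, h φ]
  ring

theorem IsWeakDeriv.unique {n : ℕ} {j : Fin n} {f g g' : Hilb n}
    (h : IsWeakDeriv j f g) (h' : IsWeakDeriv j f g') : g = g' := by
  refine Lp.ext (ae_eq_of_integral_contDiff_smul_eq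
    ((Lp.memLp g).locallyIntegrable (by norm_num))
    ((Lp.memLp g').locallyIntegrable (by norm_num)) ?_)
  intro φ hφ hc
  have hs : ContDiff ℝ (⊤ : ℕ∞) (fun x => (φ x : ℂ)) := Complex.ofRealCLM.contDiff.comp hφ
  have hc' : HasCompactSupport (fun x => (φ x : ℂ)) :=
    hc.comp_left (g := fun r : ℝ => (r : ℂ)) (by simp)
  have e := neg_injective ((h (hc'.toSchwartzMap hs)).symm.trans (h' (hc'.toSchwartzMap hs)))
  simpa [mul_comm] using e

theorem IsWeakDeriv.zero {n : ℕ} (j : Fin n) : IsWeakDeriv j (0 : Hilb n) 0 := by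
  have key : ∀ ψ : 𝓢(Config n, ℂ), ∫ x, (0 : Hilb n) x * ψ x = 0 := by
    intro ψ
    refine integral_eq_zero_of_ae ?_
    filter_upwards [Lp.coeFn_zero ℂ 2 (volume : Measure (Config n))] with x hx
    simp only [hx, Pi.zero_apply, zero_mul]
  intro φ
  rw [key, key, neg_zero]

/-- The space of all `f` in `L²(ℝⁿ)` whose weak derivative `∂f/∂x_j` is in `L²(ℝⁿ)`. -/
def momentumDomain {n : ℕ} (j : Fin n) : Submodule ℂ (Hilb n) where
  carrier := {f | ∃ g, IsWeakDeriv j f g}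
  zero_mem' := ⟨0, IsWeakDeriv.zero j⟩
  add_mem' := by
    rintro f f' ⟨g, hg⟩ ⟨g', hg'⟩
    exact ⟨g + g', hg.add hg'⟩
  smul_mem' := by
    rintro c f ⟨g, hg⟩
    exact ⟨c • g, hg.smul c⟩

/-- The (unique) weak derivative `∂f/∂x_j` of an element of `momentumDomain j`. -/
def weakDeriv {n : ℕ} {j : Fin n} (f : momentumDomain j) : Hilb n :=
  Classical.choose f.2

theorem weakDeriv_spec {n : ℕ} {j : Fin n} (f : momentumDomain j) :
    IsWeakDeriv j (f : Hilb n) (weakDeriv f) :=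
  Classical.choose_spec f.2

/-- The momentum operator `-iħ ∂/∂x_j`, with its maximal domain. -/
def momentum {n : ℕ} (hbar : ℝ) (j : Fin n) : Hilb n →ₗ.[ℂ] Hilb n where
  domain := momentumDomain j
  toFun :=
    { toFun := fun f => (-Complex.I * hbar) • weakDeriv f
      map_add' := by
        intro f f'
        rw [← smul_add]
        congr 1
        exact (weakDeriv_spec (f + f')).unique ((weakDeriv_spec f).add (weakDeriv_spec f'))
      map_smul' := by
        intro c f
        rw [RingHom.id_apply, smul_comm c]
        congr 1
        exact (weakDeriv_spec (c • f)).unique ((weakDeriv_spec f).smul c) }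

/-! ### The `n`-mode system -/

/-- The phase-space index set. Its lexicographic order is that of `(q₁, p₁, …, qₙ, pₙ)`: the pair
`(j, 0)` is the index of the `j`-th position and `(j, 1)` that of the `j`-th momentum. -/
abbrev Idx (n : ℕ) : Type := Fin n × Fin 2

/-- The canonical operators `ξ = (q₁, p₁, …, qₙ, pₙ)`. -/
def xi {n : ℕ} (hbar : ℝ) (a : Idx n) : Hilb n →ₗ.[ℂ] Hilb n :=
  if a.2 = 0 then position a.1 else momentum hbar a.1

/-- The symplectic metric `β = 1 ⊗ iσ₂ = diag(iσ₂, …, iσ₂)`. -/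
def beta (n : ℕ) : Matrix (Idx n) (Idx n) ℝ :=
  (1 : Matrix (Fin n) (Fin n) ℝ) ⊗ₖ !![0, 1; -1, 0]

/-- The symplectic group `Sp(2n, ℝ)`: the real `2n × 2n` matrices with `S β Sᵀ = β`. -/
def Sp (n : ℕ) : Set (Matrix (Idx n) (Idx n) ℝ) :=
  {S | S * beta n * S.transpose = beta n}

/-- `U` is a metaplectic unitary for `S`, i.e. `U⁻¹ ξ_a U = ∑ b, S_ab ξ_b` for all `a`, as operators
on the common domain of `ξ₁, …, ξ_{2n}`: each `f` in all the domains of the `ξ_b` is mapped by `U`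
into all of them, and `ξ_a (U f) = U (∑ b, S_ab ξ_b f)`. -/
def IsMetaplectic {n : ℕ} (hbar : ℝ) (S : Matrix (Idx n) (Idx n) ℝ)
    (U : unitary (Hilb n →L[ℂ] Hilb n)) : Prop :=
  ∀ (f : Hilb n) (hf : ∀ b, f ∈ (xi hbar b).domain) (a : Idx n),
    ∃ h : (U : Hilb n →L[ℂ] Hilb n) f ∈ (xi hbar a).domain,
      xi hbar a ⟨(U : Hilb n →L[ℂ] Hilb n) f, h⟩ =
        (U : Hilb n →L[ℂ] Hilb n) (∑ b, (S a b : ℂ) • xi hbar b ⟨f, hf b⟩)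

/-- The state has finite second moments `⟨ξ_a²⟩`; exactly then its variance matrix exists. -/
def HasFiniteSecondMoments {n : ℕ} (hbar : ℝ) (ρ : Hilb n →L[ℂ] Hilb n) : Prop :=
  ∀ a : Idx n, ∃ t, HasMoment ρ (xi hbar a) (xi hbar a) t

/-- The variance matrix `V_ab = ½ ⟨{ξ_a, ξ_b}⟩ - ⟨ξ_a⟩ ⟨ξ_b⟩` of the state `ρ`. -/
def varianceMatrix {n : ℕ} (hbar : ℝ) (ρ : Hilb n →L[ℂ] Hilb n) : Matrix (Idx n) (Idx n) ℂ :=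
  Matrix.of fun a b => covariance ρ (xi hbar a) (xi hbar b)

/-- The uncertainty relation `V + (iħ/2) β ≥ 0` for a variance matrix `V`. -/
def UncertaintyRelation {n : ℕ} (hbar : ℝ) (V : Matrix (Idx n) (Idx n) ℂ) : Prop :=
  (V + (Complex.I * hbar / 2) • (beta n).map Complex.ofReal).PosSemidef

/-- The transformed state `U ρ U⁻¹`. -/
def conjState {n : ℕ} (U : unitary (Hilb n →L[ℂ] Hilb n)) (ρ : Hilb n →L[ℂ] Hilb n) :
    Hilb n →L[ℂ] Hilb n :=
  (U : Hilb n →L[ℂ] Hilb n) * ρ * ((U⁻¹ : unitary (Hilb n →L[ℂ] Hilb n)) : Hilb n →L[ℂ] Hilb n)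

end QuantumModes

end

noncomputable section

namespace QuantumModes

/-! ### Metaplectic unitaries from maps of the Schwartz space -/

/-! Existence. Matrices that have a metaplectic unitary are closed under products
(`IsMetaplectic.mul`), so it suffices to treat generators of the symplectic group (`mem_of_mem_Sp`):
momentum shears, linear coordinate changes and one rescaled Fourier rotation. They are implemented
by quadratic phases, normalized substitutions and the Fourier transform, all L²-isometric bijections
of Schwartz space. Domains cause no trouble because each ξ_a is a maximal weak operator: `ξ_a f =
g`, domain membership included, can be tested against Schwartz functions (`exists_xi_eq_iff`). An
intertwining relation between transposes on Schwartz space therefore yields the relation on the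
whole common domain (`exists_isMetaplectic_of_schwartz`).

Covariance. Finite second moments make T_b = ξ_b √ρ a bounded Hilbert–Schmidt operator
(`HasMoment.exists_isCompSqrt`), and moments become Hilbert–Schmidt inner products, independent of
the basis. Since √(UρU⁻¹) = U √ρ U⁻¹, the new operators are U (∑ S_ab T_b) U⁻¹, so first and second
moments transform linearly and bilinearly. Finally SβSᵀ = β turns V + (iħ/2)β into its congruence by
the invertible matrix S, which preserves and reflects positivity. -/

/-- The bilinear pairing of `L²(ℝⁿ)` with Schwartz functions. -/
def pairing {n : ℕ} (f : Hilb n) (φ : 𝓢(Config n, ℂ)) : ℂ := ∫ x, f x * φ x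

theorem pairing_add_right {n : ℕ} (f : Hilb n) (φ ψ : 𝓢(Config n, ℂ)) :
    pairing f (φ + ψ) = pairing f φ + pairing f ψ := by
  unfold pairing
  rw [← integral_add (integrable_mul_schwartz f φ) (integrable_mul_schwartz f ψ)]
  simp [mul_add]

theorem pairing_smul_right {n : ℕ} (f : Hilb n) (c : ℂ) (φ : 𝓢(Config n, ℂ)) :
    pairing f (c • φ) = c * pairing f φ := by
  unfold pairing
  rw [← integral_const_mul]
  simp [mul_left_comm]

theorem pairing_add_left {n : ℕ} (f g : Hilb n) (φ : 𝓢(Config n, ℂ)) :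
    pairing (f + g) φ = pairing f φ + pairing g φ := by
  unfold pairing
  rw [← integral_add (integrable_mul_schwartz f φ) (integrable_mul_schwartz g φ)]
  refine integral_congr_ae ?_
  filter_upwards [Lp.coeFn_add f g] with x hx
  rw [hx, Pi.add_apply, add_mul]

theorem pairing_smul_left {n : ℕ} (c : ℂ) (f : Hilb n) (φ : 𝓢(Config n, ℂ)) :
    pairing (c • f) φ = c * pairing f φ := by
  unfold pairing
  rw [← integral_const_mul]
  refine integral_congr_ae ?_
  filter_upwards [Lp.coeFn_smul c f] with x hx
  rw [hx, Pi.smul_apply, smul_eq_mul, mul_assoc]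

/-- The pairing as a linear form in the Schwartz function. -/
def pairingRight {n : ℕ} (f : Hilb n) : 𝓢(Config n, ℂ) →ₗ[ℂ] ℂ where
  toFun := pairing f
  map_add' := pairing_add_right f
  map_smul' c φ := pairing_smul_right f c φ

/-- The pairing as a linear form in the square-integrable function. -/
def pairingLeft {n : ℕ} (φ : 𝓢(Config n, ℂ)) : Hilb n →ₗ[ℂ] ℂ where
  toFun f := pairing f φ
  map_add' f g := pairing_add_left f g φ
  map_smul' c f := pairing_smul_left c f φ

theorem pairing_sum_right {n : ℕ} {ι : Type*} (s : Finset ι) (f : Hilb n)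
    (φ : ι → 𝓢(Config n, ℂ)) : pairing f (∑ i ∈ s, φ i) = ∑ i ∈ s, pairing f (φ i) :=
  map_sum (pairingRight f) φ s

theorem pairing_sum_left {n : ℕ} {ι : Type*} (s : Finset ι) (f : ι → Hilb n)
    (φ : 𝓢(Config n, ℂ)) : pairing (∑ i ∈ s, f i) φ = ∑ i ∈ s, pairing (f i) φ :=
  map_sum (pairingLeft φ) f s

/-- Cauchy–Schwarz, after writing the bilinear pairing as the inner product with the conjugate of
`φ`. -/
theorem norm_pairing_le {n : ℕ} (f : Hilb n) (φ : 𝓢(Config n, ℂ)) :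
    ‖pairing f φ‖ ≤ ‖φ.toLp 2‖ * ‖f‖ := by
  have h : pairing f φ = ⟪((φ.memLp 2).star).toLp, f⟫_ℂ := by
    rw [L2.inner_def]
    refine integral_congr_ae ?_
    filter_upwards [((φ.memLp 2).star).coeFn_toLp] with x hx
    simp [hx]
  rw [h]
  refine (norm_inner_le_norm _ _).trans (le_of_eq ?_)
  congr 1
  rw [SchwartzMap.norm_toLp, Lp.norm_toLp]
  congr 1
  exact eLpNorm_congr_norm_ae (Filter.Eventually.of_forall fun x => by simp)

theorem continuous_pairing_left {n : ℕ} (φ : 𝓢(Config n, ℂ)) :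
    Continuous fun f : Hilb n => pairing f φ :=
  AddMonoidHomClass.continuous_of_bound (pairingLeft φ) ‖φ.toLp 2 volume‖
    fun f => norm_pairing_le f φ

theorem pairing_toLp {n : ℕ} (f φ : 𝓢(Config n, ℂ)) :
    pairing (f.toLp 2) φ = ∫ x, f x * φ x := by
  refine integral_congr_ae ?_
  filter_upwards [f.coeFn_toLp 2] with x hx
  rw [hx]

theorem ae_eq_of_integral_mul_schwartz {n : ℕ} {u v : Config n → ℂ}
    (hu : LocallyIntegrable u) (hv : LocallyIntegrable v)
    (h : ∀ φ : 𝓢(Config n, ℂ), ∫ x, u x * φ x = ∫ x, v x * φ x) : u =ᵐ[volume] v := by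
  refine ae_eq_of_integral_contDiff_smul_eq hu hv ?_
  intro φ hφ hc
  have hs : ContDiff ℝ (⊤ : ℕ∞) (fun x => (φ x : ℂ)) := Complex.ofRealCLM.contDiff.comp hφ
  have hc' : HasCompactSupport (fun x => (φ x : ℂ)) :=
    hc.comp_left (g := fun r : ℝ => (r : ℂ)) (by simp)
  simpa [mul_comm] using h (hc'.toSchwartzMap hs)

theorem hasTemperateGrowth_coord {n : ℕ} (j : Fin n) :
    (fun x : Config n => (x j : ℂ)).HasTemperateGrowth :=
  (Complex.ofRealCLM.comp (EuclideanSpace.proj (𝕜 := ℝ) j)).hasTemperateGrowth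

/-- The transposes, for the bilinear pairing, of the canonical operators on Schwartz space. -/
def xiTranspose {n : ℕ} (hbar : ℝ) (a : Idx n) : 𝓢(Config n, ℂ) →ₗ[ℂ] 𝓢(Config n, ℂ) :=
  if a.2 = 0 then (SchwartzMap.smulLeftCLM ℂ fun x : Config n => (x a.1 : ℂ)).toLinearMap
  -- Integration by parts flips the sign: the transpose of -iħ∂ is +iħ∂.
  else (Complex.I * hbar) •
    (LineDeriv.lineDerivOpCLM ℂ 𝓢(Config n, ℂ) (EuclideanSpace.single a.1 (1 : ℝ))).toLinearMap

theorem xiTranspose_zero_apply {n : ℕ} (hbar : ℝ) (j : Fin n) (φ : 𝓢(Config n, ℂ))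
    (x : Config n) : xiTranspose hbar (j, 0) φ x = x j * φ x := by
  simp [xiTranspose, SchwartzMap.smulLeftCLM_apply_apply (hasTemperateGrowth_coord j)]

theorem xiTranspose_one_apply {n : ℕ} (hbar : ℝ) (j : Fin n) (φ : 𝓢(Config n, ℂ)) :
    xiTranspose hbar (j, 1) φ =
      (Complex.I * hbar) • ∂_{EuclideanSpace.single j (1 : ℝ)} φ := by
  simp [xiTranspose]

theorem pairing_position {n : ℕ} {j : Fin n} (f : Hilb n) (φ : 𝓢(Config n, ℂ)) (hbar : ℝ) :
    pairing f (xiTranspose hbar (j, 0) φ) = ∫ x, (x j * f x) * φ x := by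
  unfold pairing
  congr 1 with x
  rw [xiTranspose_zero_apply]
  ring

/-- Before `f` is known to lie in the domain, local integrability is all that holds; it is enough to
identify the product with a weak limit candidate in L². -/
theorem locallyIntegrable_coord_mul {n : ℕ} (j : Fin n) (f : Hilb n) :
    LocallyIntegrable fun x : Config n => (x j : ℂ) * f x := by
  have hf := (Lp.memLp f).locallyIntegrable (by norm_num)
  have := (locallyIntegrableOn_univ.mpr hf).continuousOn_mul (g := fun x : Config n => (x j : ℂ))
    (by fun_prop) isOpen_univ.isLocallyClosed
  exact locallyIntegrableOn_univ.mp this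

/-- The canonical operators are the maximal weak extensions of their transposes. -/
theorem exists_xi_eq_iff {n : ℕ} {hbar : ℝ} (hb : 0 < hbar) (a : Idx n) (f g : Hilb n) :
    (∃ h : f ∈ (xi hbar a).domain, xi hbar a ⟨f, h⟩ = g) ↔
      ∀ φ, pairing f (xiTranspose hbar a φ) = pairing g φ := by
  obtain ⟨j, k⟩ := a
  fin_cases k
  · change (∃ h : f ∈ positionDomain j, (memLp_coord_mul ⟨f, h⟩).toLp = g) ↔
      ∀ φ, pairing f (xiTranspose hbar (j, 0) φ) = pairing g φ
    simp only [pairing_position]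
    constructor
    · rintro ⟨h, rfl⟩ φ
      refine integral_congr_ae ?_
      filter_upwards [(memLp_coord_mul ⟨f, h⟩).coeFn_toLp] with x hx
      rw [hx]
    · intro h
      have e := ae_eq_of_integral_mul_schwartz (locallyIntegrable_coord_mul j f)
        ((Lp.memLp g).locallyIntegrable (by norm_num)) h
      exact ⟨(memLp_congr_ae e).mpr (Lp.memLp g), Lp.ext ((MemLp.coeFn_toLp _).trans e)⟩
  · change (∃ h : f ∈ momentumDomain j, (-Complex.I * hbar) • weakDeriv ⟨f, h⟩ = g) ↔
      ∀ φ, pairing f (xiTranspose hbar (j, 1) φ) = pairing g φ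
    have hc : Complex.I * hbar ≠ 0 := by simp [hb.ne']
    simp only [xiTranspose_one_apply, pairing_smul_right]
    constructor
    · rintro ⟨h, rfl⟩ φ
      have := weakDeriv_spec (⟨f, h⟩ : momentumDomain j) φ
      change pairing f _ = -pairing _ φ at this
      rw [this, pairing_smul_left]
      ring
    · intro h
      have hw : IsWeakDeriv j f ((-(Complex.I * hbar))⁻¹ • g) := by
        intro φ
        change pairing f _ = -pairing _ φ
        rw [pairing_smul_left, ← h φ]
        field_simp
      refine ⟨⟨_, hw⟩, ?_⟩
      rw [(weakDeriv_spec ⟨f, _, hw⟩).unique hw, smul_smul, neg_mul,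
        mul_inv_cancel₀ (neg_ne_zero.mpr hc), one_smul]

theorem pairing_xi {n : ℕ} {hbar : ℝ} (hb : 0 < hbar) (a : Idx n) (f : Hilb n)
    (h : f ∈ (xi hbar a).domain) (φ : 𝓢(Config n, ℂ)) :
    pairing (xi hbar a ⟨f, h⟩) φ = pairing f (xiTranspose hbar a φ) :=
  ((exists_xi_eq_iff hb a f _).mp ⟨h, rfl⟩ φ).symm

/-- An `L²`-isometric bijection of Schwartz space whose transpose intertwines the canonical
operators extends to a metaplectic unitary. -/
theorem exists_isMetaplectic_of_schwartz {n : ℕ} {hbar : ℝ} (hb : 0 < hbar)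
    (S : Matrix (Idx n) (Idx n) ℝ) (T : 𝓢(Config n, ℂ) ≃ₗ[ℂ] 𝓢(Config n, ℂ))
    (V : 𝓢(Config n, ℂ) → 𝓢(Config n, ℂ))
    (hT : ∀ φ, ‖(T φ).toLp 2‖ = ‖φ.toLp 2‖)
    (hTV : ∀ φ ψ, ∫ x, T φ x * ψ x = ∫ x, φ x * V ψ x)
    (hV : ∀ a φ, V (xiTranspose hbar a φ) = ∑ b, (S a b : ℂ) • xiTranspose hbar b (V φ)) :
    ∃ U, IsMetaplectic hbar S U := by
  have hd : DenseRange (SchwartzMap.toLpCLM ℂ (E := Config n) ℂ 2 volume).toLinearMap :=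
    SchwartzMap.denseRange_toLpCLM ENNReal.ofNat_ne_top
  let E : Hilb n ≃ₗᵢ[ℂ] Hilb n := T.extendOfIsometry
    (SchwartzMap.toLpCLM ℂ (E := Config n) ℂ 2 volume).toLinearMap
    (SchwartzMap.toLpCLM ℂ (E := Config n) ℂ 2 volume).toLinearMap hd hd hT
  have hE : ∀ φ : 𝓢(Config n, ℂ), E (φ.toLp 2) = (T φ).toLp 2 :=
    fun φ => LinearEquiv.extendOfIsometry_eq T _ _ hd hd hT φ
  -- `V` remains the transpose of the extension: both sides are continuous in `f` and agree on the
  -- dense Schwartz space.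
  have hdual : ∀ f φ, pairing (E f) φ = pairing f (V φ) := by
    intro f φ
    refine hd.induction_on (p := fun f => pairing (E f) φ = pairing f (V φ)) f
      (isClosed_eq ((continuous_pairing_left φ).comp E.continuous)
        (continuous_pairing_left (V φ))) ?_
    intro g
    change pairing (E (g.toLp 2)) φ = pairing (g.toLp 2) (V φ)
    rw [hE, pairing_toLp, pairing_toLp, hTV]
  refine ⟨Unitary.linearIsometryEquiv.symm E, ?_⟩
  intro f hf a
  change ∃ h : E f ∈ (xi hbar a).domain, xi hbar a ⟨E f, h⟩ = E _
  -- Weak testing gives domain membership and the formula together; `V` moves the test function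
  -- across `E`.
  rw [exists_xi_eq_iff hb]
  intro φ
  rw [hdual, hdual, hV, pairing_sum_right, pairing_sum_left]
  refine Finset.sum_congr rfl fun b _ => ?_
  rw [pairing_smul_right, pairing_smul_left, pairing_xi hb]

/-- `U'` preserves the common domain, so the relation for `U` applies to `U' f`. The order of
factors is kept because the coefficients are scalars that pass through both unitaries. -/
theorem IsMetaplectic.mul {n : ℕ} {hbar : ℝ} {S S' : Matrix (Idx n) (Idx n) ℝ}
    {U U' : unitary (Hilb n →L[ℂ] Hilb n)} (h : IsMetaplectic hbar S U)
    (h' : IsMetaplectic hbar S' U') : IsMetaplectic hbar (S * S') (U * U') := by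
  intro f hf a
  obtain ⟨ha, he⟩ := h _ (fun b => (h' f hf b).1) a
  refine ⟨ha, he.trans ?_⟩
  change _ = (U : Hilb n →L[ℂ] Hilb n) ((U' : Hilb n →L[ℂ] Hilb n) _)
  congr 1
  simp only [(h' f hf _).2, Matrix.mul_apply, map_sum, map_smul, Finset.smul_sum, smul_smul,
    Complex.ofReal_sum, Complex.ofReal_mul, Finset.sum_smul]
  exact Finset.sum_comm

/-! ### Block matrices on phase space -/

/-- The matrix on phase space with position-position block `A`, position-momentum block `B`,
momentum-position block `C` and momentum-momentum block `D`. -/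
def blockMatrix {n : ℕ} (A B C D : Matrix (Fin n) (Fin n) ℝ) : Matrix (Idx n) (Idx n) ℝ :=
  Matrix.of fun a b => !![A a.1 b.1, B a.1 b.1; C a.1 b.1, D a.1 b.1] a.2 b.2

section Block

variable {n : ℕ} (A B C D A' B' C' D' : Matrix (Fin n) (Fin n) ℝ) (i j : Fin n)

@[simp] theorem blockMatrix_zero_zero : blockMatrix A B C D (i, 0) (j, 0) = A i j := rfl
@[simp] theorem blockMatrix_zero_one : blockMatrix A B C D (i, 0) (j, 1) = B i j := rfl
@[simp] theorem blockMatrix_one_zero : blockMatrix A B C D (i, 1) (j, 0) = C i j := rfl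
@[simp] theorem blockMatrix_one_one : blockMatrix A B C D (i, 1) (j, 1) = D i j := rfl

theorem ext_blocks {M N : Matrix (Idx n) (Idx n) ℝ}
    (h : ∀ i j, M (i, 0) (j, 0) = N (i, 0) (j, 0) ∧ M (i, 0) (j, 1) = N (i, 0) (j, 1) ∧
      M (i, 1) (j, 0) = N (i, 1) (j, 0) ∧ M (i, 1) (j, 1) = N (i, 1) (j, 1)) : M = N := by
  ext ⟨i, k⟩ ⟨j, l⟩
  obtain ⟨h1, h2, h3, h4⟩ := h i j
  fin_cases k <;> fin_cases l <;> assumption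

theorem exists_eq_blockMatrix (M : Matrix (Idx n) (Idx n) ℝ) :
    ∃ A B C D, M = blockMatrix A B C D :=
  ⟨.of fun i j => M (i, 0) (j, 0), .of fun i j => M (i, 0) (j, 1),
    .of fun i j => M (i, 1) (j, 0), .of fun i j => M (i, 1) (j, 1),
    ext_blocks fun _ _ => ⟨rfl, rfl, rfl, rfl⟩⟩

theorem blockMatrix_mul : blockMatrix A B C D * blockMatrix A' B' C' D' =
    blockMatrix (A * A' + B * C') (A * B' + B * D') (C * A' + D * C') (C * B' + D * D') := by
  refine ext_blocks fun i j => ?_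
  simp [Matrix.mul_apply, Fintype.sum_prod_type, Fin.sum_univ_two, Finset.sum_add_distrib]

theorem blockMatrix_transpose :
    (blockMatrix A B C D).transpose =
      blockMatrix A.transpose C.transpose B.transpose D.transpose :=
  ext_blocks fun _ _ => ⟨rfl, rfl, rfl, rfl⟩

theorem beta_eq_blockMatrix : beta n = blockMatrix 0 1 (-1) 0 := by
  refine ext_blocks fun i j => ?_
  simp [beta, Matrix.kroneckerMap_apply]

variable {A B C D A' B' C' D'} in
theorem blockMatrix_inj :
    blockMatrix A B C D = blockMatrix A' B' C' D' ↔ A = A' ∧ B = B' ∧ C = C' ∧ D = D' := by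
  constructor
  · intro h
    refine ⟨?_, ?_, ?_, ?_⟩ <;> ext i j
    · exact congr_fun₂ h (i, 0) (j, 0)
    · exact congr_fun₂ h (i, 0) (j, 1)
    · exact congr_fun₂ h (i, 1) (j, 0)
    · exact congr_fun₂ h (i, 1) (j, 1)
  · rintro ⟨rfl, rfl, rfl, rfl⟩
    rfl

/-- The fourth block equation of SβSᵀ = β is minus the transpose of the second, hence redundant. -/
theorem blockMatrix_mem_Sp_iff : blockMatrix A B C D ∈ Sp n ↔
    A * B.transpose = B * A.transpose ∧ C * D.transpose = D * C.transpose ∧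
      A * D.transpose - B * C.transpose = 1 := by
  change blockMatrix A B C D * beta n * (blockMatrix A B C D).transpose = beta n ↔ _
  rw [beta_eq_blockMatrix, blockMatrix_transpose, blockMatrix_mul, blockMatrix_mul,
    blockMatrix_inj]
  simp only [mul_zero, mul_one, mul_neg, zero_add, add_zero, neg_mul]
  constructor
  · rintro ⟨h1, h2, -, h4⟩
    exact ⟨by rwa [neg_add_eq_zero, eq_comm] at h1, by rwa [neg_add_eq_zero, eq_comm] at h4,
      by rwa [neg_add_eq_sub] at h2⟩
  · rintro ⟨h1, h2, h3⟩
    refine ⟨by rw [neg_add_eq_zero, h1], by rwa [neg_add_eq_sub], ?_, by rw [neg_add_eq_zero, h2]⟩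
    have := congrArg Matrix.transpose h3
    rw [Matrix.transpose_sub, Matrix.transpose_mul, Matrix.transpose_mul,
      Matrix.transpose_transpose, Matrix.transpose_transpose, Matrix.transpose_one] at this
    rw [← this]
    abel

end Block

/-- The real pencil through the upper blocks of a symplectic matrix contains an invertible
matrix. -/
theorem exists_isUnit_add_smul {n : ℕ} {A B : Matrix (Fin n) (Fin n) ℝ}
    (hAB : A * B.transpose = B * A.transpose)
    (hinj : ∀ v, Matrix.vecMul v A = 0 → Matrix.vecMul v B = 0 → v = 0) :
    ∃ t : ℝ, IsUnit (A + t • B) := by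
  by_contra! hcon
  -- If every real member of the pencil is singular, this determinant is the zero polynomial and so
  -- vanishes at t = i as well.
  let p : Polynomial ℝ :=
    (A.map Polynomial.C + (Polynomial.X : Polynomial ℝ) • B.map Polynomial.C).det
  have hp : p = 0 := by
    refine Polynomial.funext fun t => ?_
    have h := hcon t
    rw [Matrix.isUnit_iff_isUnit_det, isUnit_iff_ne_zero, not_not] at h
    rw [Polynomial.eval_zero, ← h, ← Polynomial.coe_evalRingHom, RingHom.map_det]
    congr 1
    ext i j
    simp
    exact mul_comm _ _
  have hdet : (A.map Complex.ofReal + Complex.I • B.map Complex.ofReal).det = 0 := by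
    rw [← map_zero (Polynomial.eval₂RingHom Complex.ofRealHom Complex.I), ← hp, RingHom.map_det]
    congr 1
    ext i j
    simp
    exact mul_comm _ _
  obtain ⟨w, hw, hw0⟩ := Matrix.exists_vecMul_eq_zero_iff.mpr hdet
  let x : Fin n → ℝ := fun i => (w i).re
  let y : Fin n → ℝ := fun i => (w i).im
  have hre : Matrix.vecMul x A = Matrix.vecMul y B := by
    ext j
    have := congrArg Complex.re (congr_fun hw0 j)
    simp only [Matrix.vecMul, dotProduct, Matrix.add_apply, Matrix.smul_apply, Matrix.map_apply,
      smul_eq_mul, Pi.zero_apply, Complex.zero_re, Complex.re_sum, Complex.mul_re, Complex.add_re,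
      Complex.add_im, Complex.ofReal_re, Complex.ofReal_im, Complex.I_re, Complex.I_im,
      Complex.mul_im] at this
    rw [← sub_eq_zero, ← this]
    simp only [Matrix.vecMul, dotProduct, ← Finset.sum_sub_distrib, x, y]
    exact Finset.sum_congr rfl fun i _ => by ring
  have him : Matrix.vecMul y A = -Matrix.vecMul x B := by
    ext j
    have := congrArg Complex.im (congr_fun hw0 j)
    simp only [Matrix.vecMul, dotProduct, Matrix.add_apply, Matrix.smul_apply, Matrix.map_apply,
      smul_eq_mul, Pi.zero_apply, Complex.zero_im, Complex.im_sum, Complex.mul_re, Complex.add_re,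
      Complex.add_im, Complex.ofReal_re, Complex.ofReal_im, Complex.I_re, Complex.I_im,
      Complex.mul_im] at this
    rw [← sub_eq_zero, ← this, Pi.neg_apply, sub_neg_eq_add]
    simp only [Matrix.vecMul, dotProduct, ← Finset.sum_add_distrib, x, y]
    exact Finset.sum_congr rfl fun i _ => by ring
  -- Write w = x + iy for a left null vector of A + iB. Symmetry of ABᵀ, with xA = yB and yA = -xB,
  -- gives |yB|² = -|xB|², so both vanish.
  have hsymm : Matrix.vecMul x A ⬝ᵥ Matrix.vecMul y B =
      Matrix.vecMul x B ⬝ᵥ Matrix.vecMul y A := by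
    have h1 := congrArg (fun M => Matrix.vecMul x M ⬝ᵥ y) hAB
    simp only [← Matrix.vecMul_vecMul] at h1
    simpa only [← Matrix.dotProduct_mulVec, Matrix.mulVec_transpose] using h1
  rw [hre, him, dotProduct_neg] at hsymm
  have hy : 0 ≤ Matrix.vecMul y B ⬝ᵥ Matrix.vecMul y B :=
    Finset.sum_nonneg fun i _ => mul_self_nonneg _
  have hx : 0 ≤ Matrix.vecMul x B ⬝ᵥ Matrix.vecMul x B :=
    Finset.sum_nonneg fun i _ => mul_self_nonneg _
  have hyB : Matrix.vecMul y B = 0 := dotProduct_self_eq_zero.mp (by linarith)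
  have hxB : Matrix.vecMul x B = 0 := dotProduct_self_eq_zero.mp (by linarith)
  have hx0 := hinj x (hre.trans hyB) hxB
  have hy0 := hinj y (by rw [him, hxB, neg_zero]) hyB
  exact hw (funext fun i => Complex.ext (congr_fun hx0 i) (congr_fun hy0 i))

/-- A symplectic matrix with invertible upper left block is a product of a momentum shear, a
linear change of coordinates and a position shear. -/
theorem blockMatrix_factorization {n : ℕ} {A B C D : Matrix (Fin n) (Fin n) ℝ} (hA : IsUnit A)
    (hS : blockMatrix A B C D ∈ Sp n) :
    ∃ P Q : Matrix (Fin n) (Fin n) ℝ, P.IsSymm ∧ Q.IsSymm ∧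
      blockMatrix A B C D =
        blockMatrix 1 0 P 1 * (blockMatrix A 0 0 (A⁻¹).transpose * blockMatrix 1 Q 0 1) := by
  obtain ⟨h1, h2, h3⟩ := (blockMatrix_mem_Sp_iff A B C D).mp hS
  have hd := (Matrix.isUnit_iff_isUnit_det A).mp hA
  have hdT : IsUnit A.transpose.det := by rwa [Matrix.det_transpose]
  have hQ : (A⁻¹ * B).IsSymm := by
    rw [Matrix.IsSymm, Matrix.transpose_mul, Matrix.transpose_nonsing_inv]
    have : A * (B.transpose * A.transpose⁻¹) = A * (A⁻¹ * B) := by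
      rw [← mul_assoc, h1, Matrix.mul_nonsing_inv_cancel_right _ _ hdT,
        Matrix.mul_nonsing_inv_cancel_left _ _ hd]
    exact hA.mul_left_cancel this
  -- The relation ADᵀ - BCᵀ = 1 determines D from the other blocks. Substituting it into CDᵀ = DCᵀ
  -- leaves exactly the symmetry of CA⁻¹.
  have hDT : D.transpose = A⁻¹ + A⁻¹ * B * C.transpose := by
    rw [← Matrix.nonsing_inv_mul_cancel_left A D.transpose hd, sub_eq_iff_eq_add.mp h3, mul_add,
      mul_one, mul_assoc]
  have hD : D = (A⁻¹).transpose + C * (A⁻¹ * B) := by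
    have := congrArg Matrix.transpose hDT
    rw [Matrix.transpose_transpose, Matrix.transpose_add, Matrix.transpose_mul,
      Matrix.transpose_transpose, hQ.eq] at this
    exact this
  have hP : (C * A⁻¹).IsSymm := by
    rw [Matrix.IsSymm, Matrix.transpose_mul]
    have h4 := h2
    rw [hDT, hD, mul_add, add_mul, ← mul_assoc, ← mul_assoc, mul_assoc C] at h4
    exact (add_right_cancel h4).symm
  refine ⟨C * A⁻¹, A⁻¹ * B, hP, hQ, ?_⟩
  rw [blockMatrix_mul, blockMatrix_mul, blockMatrix_inj]
  have hAA : A⁻¹ * A = 1 := Matrix.nonsing_inv_mul A hd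
  have hAB : A * (A⁻¹ * B) = B := Matrix.mul_nonsing_inv_cancel_left _ _ hd
  refine ⟨by simp, by simp [hAB], by simp [mul_assoc, hAA], ?_⟩
  simp only [mul_one, zero_mul, add_zero, zero_add, one_mul, hAB]
  rw [hD, mul_assoc, add_comm]

/-- A multiplicatively closed set of matrices that contains the momentum shears, the linear
changes of coordinates and one multiple of the Fourier rotation contains the symplectic group. -/
theorem mem_of_mem_Sp {n : ℕ} (G : Set (Matrix (Idx n) (Idx n) ℝ))
    (hmul : ∀ M ∈ G, ∀ N ∈ G, M * N ∈ G)
    (hshear : ∀ P : Matrix (Fin n) (Fin n) ℝ, P.IsSymm → blockMatrix 1 0 P 1 ∈ G)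
    (hlin : ∀ A : Matrix (Fin n) (Fin n) ℝ, IsUnit A →
      blockMatrix A 0 0 (A⁻¹).transpose ∈ G)
    {c : ℝ} (hc : c ≠ 0)
    (hF : blockMatrix (0 : Matrix (Fin n) (Fin n) ℝ) (c⁻¹ • 1) (-c • 1) 0 ∈ G)
    {S : Matrix (Idx n) (Idx n) ℝ} (hS : S ∈ Sp n) : S ∈ G := by
  have hQ : ∀ Q : Matrix (Fin n) (Fin n) ℝ, Q.IsSymm → blockMatrix 1 Q 0 1 ∈ G := by
    intro Q hQ
    have h1 := hlin (-1) isUnit_one.neg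
    -- Conjugation by the Fourier rotation F turns momentum shears into position shears. Since F² =
    -- -1, the inverse of F is F · (-1); the factor -c² undoes the rescaling.
    have h2 := hmul _ hF _ (hmul _ (hshear ((-c ^ 2) • Q) (by
      rw [Matrix.IsSymm, Matrix.transpose_smul, hQ.eq])) _ (hmul _ hF _ h1))
    have h3 : (-1 : Matrix (Fin n) (Fin n) ℝ)⁻¹ = -1 := Matrix.inv_eq_left_inv (by simp)
    convert h2 using 1
    rw [h3]
    simp only [blockMatrix_mul, blockMatrix_inj, Matrix.transpose_neg, Matrix.transpose_one]
    simp [smul_smul, hc]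
    ring_nf
    simp [hc]
  obtain ⟨A, B, C, D, rfl⟩ := exists_eq_blockMatrix S
  obtain ⟨h1, h2, h3⟩ := (blockMatrix_mem_Sp_iff A B C D).mp hS
  obtain ⟨t, ht⟩ := exists_isUnit_add_smul h1 (by
    intro v hvA hvB
    have := congrArg (Matrix.vecMul v) h3
    rwa [Matrix.vecMul_sub, ← Matrix.vecMul_vecMul, ← Matrix.vecMul_vecMul, hvA, hvB,
      Matrix.zero_vecMul, Matrix.zero_vecMul, sub_zero, Matrix.vecMul_one, eq_comm] at this)
  have hsymm : ∀ s : ℝ, (s • (1 : Matrix (Fin n) (Fin n) ℝ)).IsSymm := fun s => by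
    rw [Matrix.IsSymm, Matrix.transpose_smul, Matrix.transpose_one]
  -- This is S times the momentum shear by t, which makes the upper left block invertible; the shear
  -- by -t undoes it at the end.
  have hS' : blockMatrix (A + t • B) B (C + t • D) D ∈ Sp n := by
    rw [blockMatrix_mem_Sp_iff]
    refine ⟨?_, ?_, ?_⟩
    · simp [add_mul, mul_add, h1]
    · simp [add_mul, mul_add, h2]
    · rw [← h3]
      simp [add_mul, mul_add]
  obtain ⟨P, Q, hP, hQ', he⟩ := blockMatrix_factorization ht hS'
  have hmem : blockMatrix (A + t • B) B (C + t • D) D ∈ G := by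
    rw [he]
    exact hmul _ (hshear P hP) _ (hmul _ (hlin _ ht) _ (hQ Q hQ'))
  have := hmul _ hmem _ (hshear ((-t) • 1) (hsymm _))
  rw [blockMatrix_mul] at this
  simpa using this

/-! ### Metaplectic unitaries of the generators -/

theorem coord_eq_inner {n : ℕ} (j : Fin n) (x : Config n) :
    inner ℝ x (EuclideanSpace.single j (1 : ℝ)) = x j := by
  simp [EuclideanSpace.inner_single_right]

theorem smulLeftCLM_inner_single {n : ℕ} (hbar : ℝ) (j : Fin n) (φ : 𝓢(Config n, ℂ)) :
    SchwartzMap.smulLeftCLM ℂ (inner ℝ · (EuclideanSpace.single j (1 : ℝ))) φ =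
      xiTranspose hbar (j, 0) φ := by
  ext x
  rw [SchwartzMap.smulLeftCLM_apply_apply (by fun_prop), xiTranspose_zero_apply, coord_eq_inner,
    Complex.real_smul]

open FourierTransform in
/-- The Fourier transform is metaplectic. -/
theorem exists_isMetaplectic_fourier {n : ℕ} {hbar : ℝ} (hb : 0 < hbar) :
    ∃ U, IsMetaplectic hbar (blockMatrix (0 : Matrix (Fin n) (Fin n) ℝ)
      ((2 * Real.pi * hbar)⁻¹ • 1) (-(2 * Real.pi * hbar) • 1) 0) U := by
  have hpi := Real.pi_pos.ne'
  have hbC : (hbar : ℂ) ≠ 0 := by exact_mod_cast hb.ne'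
  have hpC : (Real.pi : ℂ) ≠ 0 := by exact_mod_cast hpi
  -- The Fourier transform is its own transpose for the bilinear pairing. Its kernel exp(-2πi⟨x, y⟩)
  -- is independent of ħ, whence the scale 2πħ in the matrix.
  refine exists_isMetaplectic_of_schwartz hb _ (fourierEquiv ℂ 𝓢(Config n, ℂ)) (fun φ => 𝓕 φ)
    SchwartzMap.norm_fourier_toL2_eq SchwartzMap.integral_fourier_mul_eq ?_
  rintro ⟨j, k⟩ φ
  fin_cases k
  · have h := SchwartzMap.lineDerivOp_fourier_eq φ (EuclideanSpace.single j (1 : ℝ))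
    rw [smulLeftCLM_inner_single hbar, FourierTransform.fourier_smul] at h
    simp only [Fin.zero_eta, Fintype.sum_prod_type, Fin.sum_univ_two, Fin.isValue,
      blockMatrix_zero_zero, blockMatrix_zero_one, Matrix.zero_apply, Matrix.smul_apply,
      Matrix.one_apply, smul_eq_mul, mul_ite, mul_one, mul_zero, Complex.ofReal_zero, zero_smul,
      zero_add, apply_ite Complex.ofReal, ite_smul, Finset.sum_ite_eq, Finset.mem_univ, if_true]
    rw [xiTranspose_one_apply, h, smul_smul, smul_smul]
    have hc : ((2 * Real.pi * hbar)⁻¹ : ℝ) * (Complex.I * hbar) * -(2 * Real.pi * Complex.I) =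
        (1 : ℂ) := by
      push_cast
      field_simp
      linear_combination -Complex.I_sq
    rw [hc, one_smul]
  · have h := SchwartzMap.fourier_lineDerivOp_eq φ (EuclideanSpace.single j (1 : ℝ))
    rw [smulLeftCLM_inner_single hbar] at h
    simp only [Fin.mk_one, Fintype.sum_prod_type, Fin.sum_univ_two, Fin.isValue,
      blockMatrix_one_zero, blockMatrix_one_one, Matrix.zero_apply, Matrix.smul_apply,
      Matrix.one_apply, smul_eq_mul, mul_ite, mul_one, mul_zero, Complex.ofReal_zero, zero_smul,
      add_zero, apply_ite Complex.ofReal, ite_smul, Finset.sum_ite_eq, Finset.mem_univ, if_true]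
    rw [xiTranspose_one_apply, FourierTransform.fourier_smul, h, smul_smul]
    congr 1
    push_cast
    linear_combination (2 * Real.pi * hbar : ℂ) * Complex.I_sq

theorem toEuclideanCLM_apply_coord {n : ℕ} (A : Matrix (Fin n) (Fin n) ℝ) (x : Config n)
    (j : Fin n) : Matrix.toEuclideanCLM (𝕜 := ℝ) A x j = ∑ k, A j k * x k := by
  simp [Matrix.ofLp_toEuclideanCLM, Matrix.mulVec, dotProduct]

theorem toEuclideanCLM_single {n : ℕ} (A : Matrix (Fin n) (Fin n) ℝ) (j : Fin n) :
    Matrix.toEuclideanCLM (𝕜 := ℝ) A (EuclideanSpace.single j 1) =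
      ∑ k, A k j • EuclideanSpace.single k (1 : ℝ) := by
  ext i
  simp [toEuclideanCLM_apply_coord, Pi.single_apply]

theorem hasTemperateGrowth_exp_mul_I :
    (fun t : ℝ => Complex.exp (t * Complex.I)).HasTemperateGrowth := by
  have hd : ∀ m : ℕ, iteratedDeriv m (fun t : ℝ => Complex.exp (t * Complex.I)) =
      fun t : ℝ => Complex.I ^ m * Complex.exp (t * Complex.I) := by
    intro m
    induction m with
    | zero => simp
    | succ m ih =>
      rw [iteratedDeriv_succ, ih]
      funext t
      have h := ((((hasDerivAt_id t).ofReal_comp).mul_const Complex.I).cexp).const_mul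
        (Complex.I ^ m)
      refine HasDerivAt.deriv (h.congr_deriv ?_)
      simp
      ring
  -- Every derivative has modulus one, so growth exponent 0 and constant 1 suffice.
  refine ⟨?_, fun m => ⟨0, 1, fun t => ?_⟩⟩
  · exact ((Complex.ofRealCLM.contDiff).mul contDiff_const).cexp
  · rw [norm_iteratedFDeriv_eq_norm_iteratedDeriv, hd]
    simp [Complex.norm_exp_ofReal_mul_I]

/-- The phase of the multiplier that implements a momentum shear. -/
def quadraticPhase {n : ℕ} (hbar : ℝ) (P : Matrix (Fin n) (Fin n) ℝ) (x : Config n) : ℝ :=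
  (2 * hbar)⁻¹ * inner ℝ x (Matrix.toEuclideanCLM (𝕜 := ℝ) P x)

theorem hasTemperateGrowth_quadraticPhase {n : ℕ} (hbar : ℝ) (P : Matrix (Fin n) (Fin n) ℝ) :
    (quadraticPhase hbar P).HasTemperateGrowth :=
  (Function.HasTemperateGrowth.const _).mul
    ((innerSL ℝ (E := Config n)).bilinear_hasTemperateGrowth (𝕜 := ℝ) (.id') (ContinuousLinearMap.hasTemperateGrowth _))

theorem hasTemperateGrowth_chirp {n : ℕ} (hbar : ℝ) (P : Matrix (Fin n) (Fin n) ℝ) :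
    (fun x : Config n => Complex.exp (quadraticPhase hbar P x * Complex.I)).HasTemperateGrowth :=
  hasTemperateGrowth_exp_mul_I.comp (hasTemperateGrowth_quadraticPhase hbar P)

/-- Symmetry of P makes the two terms of the product rule equal, which cancels the ½ in the phase.
-/
theorem hasFDerivAt_quadraticPhase {n : ℕ} {hbar : ℝ} (hb : 0 < hbar)
    {P : Matrix (Fin n) (Fin n) ℝ} (hP : P.IsSymm) (x : Config n) (j : Fin n) :
    ∃ L : Config n →L[ℝ] ℝ, HasFDerivAt (quadraticPhase hbar P) L x ∧
      L (EuclideanSpace.single j 1) = hbar⁻¹ * ∑ k, P j k * x k := by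
  have h := ((hasFDerivAt_id x).inner ℝ
    (Matrix.toEuclideanCLM (𝕜 := ℝ) P).hasFDerivAt).const_mul (2 * hbar)⁻¹
  refine ⟨_, h, ?_⟩
  have h1 : inner ℝ x (Matrix.toEuclideanCLM (𝕜 := ℝ) P (EuclideanSpace.single j 1)) =
      ∑ k, P j k * x k := by
    simp [toEuclideanCLM_single, inner_sum, inner_smul_right, coord_eq_inner, hP.apply]
  have h2 : inner ℝ (EuclideanSpace.single j 1) (Matrix.toEuclideanCLM (𝕜 := ℝ) P x) =
      ∑ k, P j k * x k := by
    rw [real_inner_comm, coord_eq_inner, toEuclideanCLM_apply_coord]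
  simp [h1, h2]
  field_simp
  ring

/-- Multiplication by a quadratic phase is metaplectic. -/
theorem exists_isMetaplectic_shear {n : ℕ} {hbar : ℝ} (hb : 0 < hbar)
    {P : Matrix (Fin n) (Fin n) ℝ} (hP : P.IsSymm) :
    ∃ U, IsMetaplectic hbar (blockMatrix 1 0 P 1) U := by
  have hg := hasTemperateGrowth_chirp hbar P
  have hg' : (fun x : Config n =>
      Complex.exp (-(quadraticPhase hbar P x * Complex.I))).HasTemperateGrowth := by
    have := hasTemperateGrowth_exp_mul_I.comp (hasTemperateGrowth_quadraticPhase hbar P).neg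
    convert this using 2 with x
    simp
  let T : 𝓢(Config n, ℂ) ≃ₗ[ℂ] 𝓢(Config n, ℂ) := LinearEquiv.ofLinearMap
    (SchwartzMap.smulLeftCLM ℂ fun x : Config n =>
      Complex.exp (quadraticPhase hbar P x * Complex.I)).toLinearMap
    (SchwartzMap.smulLeftCLM ℂ fun x : Config n =>
      Complex.exp (-(quadraticPhase hbar P x * Complex.I))).toLinearMap
    (LinearMap.ext fun φ => SchwartzMap.ext fun x => by
      simp [SchwartzMap.smulLeftCLM_apply_apply hg, SchwartzMap.smulLeftCLM_apply_apply hg',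
        ← mul_assoc, ← Complex.exp_add])
    (LinearMap.ext fun φ => SchwartzMap.ext fun x => by
      simp [SchwartzMap.smulLeftCLM_apply_apply hg, SchwartzMap.smulLeftCLM_apply_apply hg',
        ← mul_assoc, ← Complex.exp_add])
  have hT : ∀ φ x, T φ x = Complex.exp (quadraticPhase hbar P x * Complex.I) * φ x :=
    fun φ x => by simp [T, SchwartzMap.smulLeftCLM_apply_apply hg]
  -- A multiplication operator is its own transpose.
  refine exists_isMetaplectic_of_schwartz hb _ T T ?_ ?_ ?_
  · intro φ
    rw [SchwartzMap.norm_toLp, SchwartzMap.norm_toLp]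
    congr 1
    refine eLpNorm_congr_norm_ae (Filter.Eventually.of_forall fun x => ?_)
    rw [hT, norm_mul, Complex.norm_exp_ofReal_mul_I, one_mul]
  · intro φ ψ
    congr 1 with x
    rw [hT, hT]
    ring
  · rintro ⟨j, k⟩ φ
    ext x
    fin_cases k
    · simp [Fintype.sum_prod_type, Matrix.one_apply, hT, xiTranspose_zero_apply, ite_smul]
      ring
    · obtain ⟨L, hL, hLj⟩ := hasFDerivAt_quadraticPhase hb hP x j
      -- Multiplied by iħ, the derivative of the phase contributes -(Px)_j, which the position terms
      -- of the shear compensate.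
      have hd : (∂_{EuclideanSpace.single j (1 : ℝ)} (T φ)) x =
          Complex.exp (quadraticPhase hbar P x * Complex.I) *
            ((∂_{EuclideanSpace.single j (1 : ℝ)} φ) x +
              Complex.I * (hbar⁻¹ * ∑ k, P j k * x k : ℝ) * φ x) := by
        rw [SchwartzMap.lineDerivOp_apply_eq_fderiv, SchwartzMap.lineDerivOp_apply_eq_fderiv]
        have h := (((Complex.ofRealCLM.hasFDerivAt.comp x hL).mul_const Complex.I).cexp).mul (φ.hasFDerivAt x)
        have hTd : HasFDerivAt (T φ) _ x := h.congr_of_eventuallyEq (.of_forall (hT φ))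
        rw [hTd.fderiv]
        simp [hLj]
        ring
      have hbC : (hbar : ℂ) ≠ 0 := by exact_mod_cast hb.ne'
      have hsum : ∑ b, (blockMatrix 1 0 P 1 (j, 1) b : ℂ) • xiTranspose hbar b (T φ) =
          (∑ k, (P j k : ℂ) • xiTranspose hbar (k, 0) (T φ)) + xiTranspose hbar (j, 1) (T φ) := by
        simp [Fintype.sum_prod_type, Finset.sum_add_distrib, Matrix.one_apply,
          ite_smul]
      simp only [Fin.mk_one, hsum]
      simp only [xiTranspose_one_apply, hT, add_apply, smul_apply, sum_apply,
        xiTranspose_zero_apply, hd, map_smul, smul_eq_mul]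
      push_cast
      have hsum' : ∑ k, (P j k : ℂ) *
          (x k * (Complex.exp (quadraticPhase hbar P x * Complex.I) * φ x)) =
          (∑ k, (P j k : ℂ) * x k) *
            (Complex.exp (quadraticPhase hbar P x * Complex.I) * φ x) := by
        rw [Finset.sum_mul]
        exact Finset.sum_congr rfl fun k _ => by ring
      rw [hsum']
      field_simp
      linear_combination (-(∑ k, (P j k : ℂ) * x k) * φ x) * Complex.I_sq

/-- A linear change of coordinates rescales integrals. -/
theorem exists_integral_comp_eq {n : ℕ} (e : Config n ≃L[ℝ] Config n) :
    ∃ r : ℝ, 0 < r ∧ ∀ {E : Type} [NormedAddCommGroup E] [NormedSpace ℝ E] (F : Config n → E),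
      ∫ x, F (e x) = r • ∫ x, F x := by
  have hdet : LinearMap.det (e.toLinearEquiv : Config n →ₗ[ℝ] Config n) ≠ 0 :=
    (LinearEquiv.isUnit_det' e.toLinearEquiv).ne_zero
  -- Here r = |det e|⁻¹; one r serves both the real integrands of norms and the complex ones of
  -- pairings.
  refine ⟨_, abs_pos.mpr (inv_ne_zero hdet), fun F => ?_⟩
  refine (e.toHomeomorph.measurableEmbedding.integral_map (μ := volume) F).symm.trans ?_
  have h := Measure.map_linearMap_addHaar_eq_smul_addHaar (volume : Measure (Config n)) hdet
  change ∫ y, F y ∂(Measure.map (e.toLinearEquiv : Config n →ₗ[ℝ] Config n) volume) = _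
  rw [h, integral_smul_measure, ENNReal.toReal_ofReal (abs_nonneg _)]

/-- An invertible matrix as an automorphism of configuration space. -/
def coordChange {n : ℕ} {A : Matrix (Fin n) (Fin n) ℝ} (hA : IsUnit A) :
    Config n ≃L[ℝ] Config n :=
  ContinuousLinearEquiv.equivOfInverse (Matrix.toEuclideanCLM (𝕜 := ℝ) A)
    (Matrix.toEuclideanCLM (𝕜 := ℝ) A⁻¹)
    (fun x => by
      rw [← mul_apply_eq_comp, ← map_mul,
        Matrix.nonsing_inv_mul A ((Matrix.isUnit_iff_isUnit_det A).mp hA), map_one]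
      rfl)
    (fun x => by
      rw [← mul_apply_eq_comp, ← map_mul,
        Matrix.mul_nonsing_inv A ((Matrix.isUnit_iff_isUnit_det A).mp hA), map_one]
      rfl)

/-- A normalized linear change of coordinates is metaplectic. -/
theorem exists_isMetaplectic_linear {n : ℕ} {hbar : ℝ} (hb : 0 < hbar)
    {A : Matrix (Fin n) (Fin n) ℝ} (hA : IsUnit A) :
    ∃ U, IsMetaplectic hbar (blockMatrix A 0 0 (A⁻¹).transpose) U := by
  let e := coordChange hA
  obtain ⟨r, hr, hint⟩ := exists_integral_comp_eq e
  have hs : (√r : ℂ) ≠ 0 := by exact_mod_cast (Real.sqrt_pos.mpr hr).ne'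
  have hss : (√r : ℂ) * √r = r := by exact_mod_cast Real.mul_self_sqrt hr.le
  -- The factor √r compensates the Jacobian, making T isometric and its inverse its transpose.
  let T : 𝓢(Config n, ℂ) ≃ₗ[ℂ] 𝓢(Config n, ℂ) := LinearEquiv.ofLinearMap
    ((√r : ℂ) • (SchwartzMap.compCLMOfContinuousLinearEquiv ℂ e.symm).toLinearMap)
    ((√r : ℂ)⁻¹ • (SchwartzMap.compCLMOfContinuousLinearEquiv ℂ e).toLinearMap)
    (LinearMap.ext fun φ => SchwartzMap.ext fun x => by simp [hs])
    (LinearMap.ext fun φ => SchwartzMap.ext fun x => by simp [hs])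
  have hT : ∀ φ x, T φ x = √r * φ (e.symm x) := fun φ x => by simp [T]
  have hTV : ∀ φ x, T.symm φ x = (√r : ℂ)⁻¹ * φ (e x) := fun φ x => by simp [T]
  have hTV' : ∀ φ, T.symm φ =
    (√r : ℂ)⁻¹ • SchwartzMap.compCLMOfContinuousLinearEquiv ℂ e φ := fun φ => rfl
  refine exists_isMetaplectic_of_schwartz hb _ T T.symm ?_ ?_ ?_
  · intro φ
    rw [SchwartzMap.norm_toLp' (by simp) (by simp), SchwartzMap.norm_toLp' (by simp) (by simp)]
    congr 1
    rw [← mul_right_inj' hr.ne', ← smul_eq_mul, ← hint, ← integral_const_mul]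
    congr 1 with x
    simp [hT, mul_pow, abs_of_nonneg, hr.le]
  · intro φ ψ
    have hrC : (r : ℂ) ≠ 0 := by exact_mod_cast hr.ne'
    rw [← mul_right_inj' hrC, ← Complex.real_smul, ← hint, ← integral_const_mul]
    congr 1 with x
    rw [hT, hTV, e.symm_apply_apply, ← hss]
    field_simp
  · rintro ⟨j, k⟩ φ
    ext x
    fin_cases k
    · have hx : ((e x) j : ℂ) = ∑ k, (A j k : ℂ) * x k := by
        exact_mod_cast toEuclideanCLM_apply_coord A x j
      simp [Fintype.sum_prod_type, hTV, xiTranspose_zero_apply, hx, Finset.sum_mul,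
        Finset.mul_sum, mul_assoc, mul_left_comm]
    -- Pulling the j-th direction back through e gives column j of A⁻¹, that is, row j of its
    -- transpose.
    · have hj : EuclideanSpace.single j (1 : ℝ) =
          e (∑ k, A⁻¹ k j • EuclideanSpace.single k (1 : ℝ)) := by
        rw [← toEuclideanCLM_single]
        exact (e.apply_symm_apply _).symm
      simp [Fintype.sum_prod_type, xiTranspose_one_apply]
      simp only [hTV']
      rw [hj, smul_apply, ← SchwartzMap.lineDerivOp_compCLMOfContinuousLinearEquiv,
        SchwartzMap.lineDerivOp_apply_eq_fderiv]
      simp only [LineDeriv.lineDerivOp_smul, smul_apply, map_sum, map_smul,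
        SchwartzMap.lineDerivOp_apply_eq_fderiv, Finset.smul_sum, Finset.mul_sum]
      refine Finset.sum_congr rfl fun k _ => ?_
      simp only [Complex.real_smul, smul_eq_mul]
      ring

theorem exists_isMetaplectic {n : ℕ} {hbar : ℝ} (hb : 0 < hbar)
    {S : Matrix (Idx n) (Idx n) ℝ} (hS : S ∈ Sp n) : ∃ U, IsMetaplectic hbar S U := by
  refine mem_of_mem_Sp {M | ∃ U, IsMetaplectic hbar M U} ?_
    (fun P hP => exists_isMetaplectic_shear hb hP) (fun A hA => exists_isMetaplectic_linear hb hA)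
    (c := 2 * Real.pi * hbar) (by have := Real.pi_pos; positivity)
    (exists_isMetaplectic_fourier hb) hS
  rintro M ⟨U, hU⟩ N ⟨U', hU'⟩
  exact ⟨U * U', hU.mul hU'⟩

/-! ### Hilbert–Schmidt operators -/

/-- Passing to extended nonnegative sums allows double sums to be interchanged freely. The condition
`0 ≤ s` is needed because `ENNReal.ofReal` sends negative numbers to 0. -/
theorem hasSum_norm_sq_iff {H ι : Type} [NormedAddCommGroup H] (u : ι → H) (s : ℝ) :
    HasSum (fun i => ‖u i‖ ^ 2) s ↔ 0 ≤ s ∧ ∑' i, ‖u i‖ₑ ^ 2 = ENNReal.ofReal s := by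
  simp_rw [← ofReal_norm, ← ENNReal.ofReal_pow (norm_nonneg _)]
  constructor
  · intro h
    refine ⟨h.nonneg fun i => by positivity, ?_⟩
    rw [← ENNReal.ofReal_tsum_of_nonneg (fun i => by positivity) h.summable, h.tsum_eq]
  · rintro ⟨hs, h⟩
    have hS : Summable fun i => ‖u i‖ ^ 2 := by
      have := ENNReal.summable_toReal (f := fun i => ENNReal.ofReal (‖u i‖ ^ 2))
        (by rw [h]; exact ENNReal.ofReal_ne_top)
      simpa [ENNReal.toReal_ofReal] using this
    rw [← ENNReal.ofReal_tsum_of_nonneg (fun i => by positivity) hS,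
      ENNReal.ofReal_eq_ofReal_iff (tsum_nonneg fun i => by positivity) hs] at h
    exact h ▸ hS.hasSum

section HilbertSchmidt

variable {H : Type} [NormedAddCommGroup H] [InnerProductSpace ℂ H] [CompleteSpace H]

omit [CompleteSpace H] in
theorem tsum_enorm_inner_sq {ι : Type} (e : HilbertBasis ι ℂ H) (x : H) :
    ∑' i, ‖⟪e i, x⟫_ℂ‖ₑ ^ 2 = ‖x‖ₑ ^ 2 := by
  have h := (e.hasSum_inner_mul_inner x x).mapL Complex.reCLM
  have h' : HasSum (fun i => ‖⟪e i, x⟫_ℂ‖ ^ 2) (‖x‖ ^ 2) := by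
    convert h using 1
    · funext i
      change _ = (⟪x, e i⟫_ℂ * ⟪e i, x⟫_ℂ).re
      rw [← inner_conj_symm x (e i), Complex.conj_mul', ← Complex.ofReal_pow, Complex.ofReal_re]
    · simp [inner_self_eq_norm_sq_to_K, ← Complex.ofReal_pow]
  simp_rw [← ofReal_norm, ← ENNReal.ofReal_pow (norm_nonneg _)]
  rw [← ENNReal.ofReal_tsum_of_nonneg (fun i => by positivity) h'.summable, h'.tsum_eq]

/-- By Parseval both sides are the sum of all squared matrix entries |⟨f_j, T e_i⟩|². As the two
bases are unrelated, this yields basis independence. -/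
theorem tsum_enorm_sq_adjoint {ι κ : Type} (e : HilbertBasis ι ℂ H) (f : HilbertBasis κ ℂ H)
    (T : H →L[ℂ] H) : ∑' i, ‖T (e i)‖ₑ ^ 2 = ∑' j, ‖T.adjoint (f j)‖ₑ ^ 2 := by
  simp_rw [← tsum_enorm_inner_sq f (T _), ← tsum_enorm_inner_sq e (T.adjoint _)]
  rw [ENNReal.tsum_comm]
  refine tsum_congr fun j => tsum_congr fun i => ?_
  rw [← ofReal_norm, ← ofReal_norm, ContinuousLinearMap.adjoint_inner_right, norm_inner_symm]

theorem hasSum_norm_sq_basis {ι κ : Type} (e : HilbertBasis ι ℂ H) (f : HilbertBasis κ ℂ H)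
    {T : H →L[ℂ] H} {s : ℝ} (h : HasSum (fun i => ‖T (e i)‖ ^ 2) s) :
    HasSum (fun j => ‖T (f j)‖ ^ 2) s := by
  rw [hasSum_norm_sq_iff] at h ⊢
  rwa [tsum_enorm_sq_adjoint f f, ← tsum_enorm_sq_adjoint e f]

/-- Square-summability of an operator in every orthonormal basis. -/
def IsHilbertSchmidt (T : H →L[ℂ] H) : Prop :=
  ∀ (ι : Type) (e : HilbertBasis ι ℂ H), Summable fun i => ‖T (e i)‖ ^ 2

theorem IsHilbertSchmidt.exists_hasSum {T : H →L[ℂ] H} (hT : IsHilbertSchmidt T) :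
    ∃ s : ℝ, ∀ (ι : Type) (e : HilbertBasis ι ℂ H), HasSum (fun i => ‖T (e i)‖ ^ 2) s := by
  obtain ⟨w, b, -⟩ := exists_hilbertBasis ℂ H
  exact ⟨_, fun ι e => hasSum_norm_sq_basis b e (hT w b).hasSum⟩

omit [CompleteSpace H] in
theorem IsHilbertSchmidt.add_smul {T R : H →L[ℂ] H} (hT : IsHilbertSchmidt T)
    (hR : IsHilbertSchmidt R) (c : ℂ) : IsHilbertSchmidt (T + c • R) := by
  intro ι e
  refine Summable.of_nonneg_of_le (fun i => by positivity) (fun i => ?_)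
    (((hT ι e).mul_left 2).add ((hR ι e).mul_left (2 * ‖c‖ ^ 2)))
  have h : ‖(T + c • R) (e i)‖ ≤ ‖T (e i)‖ + ‖c‖ * ‖R (e i)‖ :=
    (norm_add_le _ _).trans_eq (congrArg _ (norm_smul _ _))
  have h2 := pow_le_pow_left₀ (norm_nonneg _) h 2
  nlinarith [sq_nonneg (‖T (e i)‖ - ‖c‖ * ‖R (e i)‖)]

/-- Polarization writes the inner product through the squared norms of T + cR with c = ±1, ±i, whose
sums do not depend on the basis. -/
theorem IsHilbertSchmidt.exists_hasSum_inner {T R : H →L[ℂ] H} (hT : IsHilbertSchmidt T)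
    (hR : IsHilbertSchmidt R) : ∃ t : ℂ, ∀ (ι : Type) (e : HilbertBasis ι ℂ H),
      HasSum (fun i => ⟪T (e i), R (e i)⟫_ℂ) t := by
  choose s hs using fun c => (hT.add_smul hR c).exists_hasSum
  refine ⟨((s 1 : ℂ) - s (-1) + ((s (-Complex.I) : ℂ) - s Complex.I) * Complex.I) / 4,
    fun ι e => ?_⟩
  have h := fun c => Complex.hasSum_ofReal.mpr (hs c ι e)
  have h4 := ((((h 1).sub (h (-1))).add
    (((h (-Complex.I)).sub (h Complex.I)).mul_right Complex.I))).div_const 4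
  refine h4.congr_fun fun i => ?_
  rw [inner_eq_sum_norm_sq_div_four]
  simp [sub_eq_add_neg]

end HilbertSchmidt

/-! ### Moments -/

section Moments

variable {H : Type} [NormedAddCommGroup H] [InnerProductSpace ℂ H] [CompleteSpace H]

/-- `T` is the everywhere defined operator `A √ρ`. -/
def IsCompSqrt (ρ : H →L[ℂ] H) (A : H →ₗ.[ℂ] H) (T : H →L[ℂ] H) : Prop :=
  ∀ x, ∃ h : CFC.sqrt ρ x ∈ A.domain, A ⟨CFC.sqrt ρ x, h⟩ = T x

theorem isCompSqrt_idOp (ρ : H →L[ℂ] H) : IsCompSqrt ρ idOp (CFC.sqrt ρ) :=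
  fun _ => ⟨trivial, rfl⟩

theorem IsCompSqrt.hasMoment_iff {ρ : H →L[ℂ] H} {A B : H →ₗ.[ℂ] H} {T R : H →L[ℂ] H}
    (hT : IsCompSqrt ρ A T) (hR : IsCompSqrt ρ B R) (t : ℂ) :
    HasMoment ρ A B t ↔ ∀ (ι : Type) (e : HilbertBasis ι ℂ H),
      HasSum (fun i => ⟪T (e i), R (e i)⟫_ℂ) t := by
  constructor
  · rintro ⟨hA, hB, h⟩ ι e
    convert h ι e using 3 with i
    · exact (hT (e i)).2.symm
    · exact (hR (e i)).2.symm
  · intro h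
    refine ⟨fun x => (hT x).1, fun x => (hR x).1, fun ι e => ?_⟩
    convert h ι e using 3 with i
    · exact (hT (e i)).2
    · exact (hR (e i)).2

/-- Some Hilbert basis exists, so the quantifier over bases is not vacuous; this pins down the value
chosen in `moment`. -/
theorem HasMoment.unique {ρ : H →L[ℂ] H} {A B : H →ₗ.[ℂ] H} {t t' : ℂ}
    (h : HasMoment ρ A B t) (h' : HasMoment ρ A B t') : t = t' := by
  obtain ⟨w, b, -⟩ := exists_hilbertBasis ℂ H
  obtain ⟨_, _, h⟩ := h
  obtain ⟨_, _, h'⟩ := h'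
  exact (h w b).unique (h' w b)

theorem HasMoment.moment_eq {ρ : H →L[ℂ] H} {A B : H →ₗ.[ℂ] H} {t : ℂ}
    (h : HasMoment ρ A B t) : moment ρ A B = t := by
  have hex : ∃ t, HasMoment ρ A B t := ⟨t, h⟩
  rw [moment, dif_pos hex]
  exact hex.choose_spec.unique h

theorem exists_hilbertBasis_mem {x : H} (hx : ‖x‖ = 1) :
    ∃ (w : Set H) (b : HilbertBasis w ℂ H) (i : w), b i = x := by
  have ho : Orthonormal ℂ ((↑) : ({x} : Set H) → H) := by
    refine ⟨fun i => ?_, fun i j hij => (hij (Subsingleton.elim i j)).elim⟩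
    rw [i.2, hx]
  obtain ⟨w, b, hw, hb⟩ := ho.exists_hilbertBasis_extension
  exact ⟨w, b, ⟨x, hw rfl⟩, by rw [hb]⟩

/-- If `⟨A²⟩` exists then `A √ρ` is a bounded Hilbert–Schmidt operator. -/
theorem HasMoment.exists_isCompSqrt {ρ : H →L[ℂ] H} {A : H →ₗ.[ℂ] H} {t : ℂ}
    (h : HasMoment ρ A A t) : ∃ T, IsCompSqrt ρ A T ∧ IsHilbertSchmidt T := by
  obtain ⟨hA, hA', hs⟩ := h
  let T₀ : H →ₗ[ℂ] H := A.toFun ∘ₗ (CFC.sqrt ρ).toLinearMap.codRestrict A.domain hA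
  have hT₀ : ∀ x, T₀ x = A ⟨CFC.sqrt ρ x, hA x⟩ := fun _ => rfl
  have hs' : ∀ (ι : Type) (e : HilbertBasis ι ℂ H), HasSum (fun i => ‖T₀ (e i)‖ ^ 2) t.re := by
    intro ι e
    have := (hs ι e).mapL Complex.reCLM
    simpa [inner_self_eq_norm_sq_to_K, ← Complex.ofReal_pow, ← hT₀] using this
  -- A unit vector extends to an orthonormal basis, so ‖T₀ x‖² is one term of a nonnegative series
  -- with sum `t.re`. Boundedness thus needs no closedness of A.
  have hunit : ∀ x, ‖x‖ = 1 → ‖T₀ x‖ ≤ √t.re := by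
    intro x hx
    obtain ⟨w, b, i, rfl⟩ := exists_hilbertBasis_mem hx
    exact Real.le_sqrt_of_sq_le (le_hasSum (hs' w b) i fun j _ => sq_nonneg _)
  have hbound : ∀ x, ‖T₀ x‖ ≤ √t.re * ‖x‖ := by
    intro x
    by_cases hx : x = 0
    · simp [hx]
    have h1 := hunit ((‖x‖⁻¹ : ℂ) • x) (by simp [norm_smul, hx])
    rw [map_smul, norm_smul, norm_inv, Complex.norm_real, norm_norm] at h1
    rwa [inv_mul_le_iff₀' (norm_pos_iff.mpr hx)] at h1
  exact ⟨T₀.mkContinuous _ hbound, fun x => ⟨hA x, rfl⟩, fun ι e => (hs' ι e).summable⟩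

/-- The squared norms ‖√ρ e_i‖² are the diagonal entries of ρ. This makes the first moments exist.
-/
theorem IsDensityOperator.isHilbertSchmidt_sqrt {ρ : H →L[ℂ] H} (hρ : IsDensityOperator ρ) :
    IsHilbertSchmidt (CFC.sqrt ρ) := by
  intro ι e
  have hn : 0 ≤ ρ := (ContinuousLinearMap.nonneg_iff_isPositive ρ).mpr hρ.1
  have hsa : (CFC.sqrt ρ).IsPositive :=
    (ContinuousLinearMap.nonneg_iff_isPositive _).mp (CFC.sqrt_nonneg ρ)
  have h := ((hρ.2 ι e).mapL Complex.reCLM).summable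
  convert h using 2 with i
  have hm : ρ (e i) = CFC.sqrt ρ (CFC.sqrt ρ (e i)) :=
    (DFunLike.congr_fun (CFC.sqrt_mul_sqrt_self ρ hn) (e i)).symm
  change _ = (⟪e i, ρ (e i)⟫_ℂ).re
  rw [hm, ← hsa.inner_left_eq_inner_right, inner_self_eq_norm_sq_to_K]
  simp [← Complex.ofReal_pow]

end Moments

/-! ### Unitary conjugation -/

section Conjugation

variable {H : Type} [NormedAddCommGroup H] [InnerProductSpace ℂ H] [CompleteSpace H]

/-- The conjugate `U T U⁻¹`. -/
def unitaryConj (U : unitary (H →L[ℂ] H)) (T : H →L[ℂ] H) : H →L[ℂ] H :=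
  (U : H →L[ℂ] H) * T * ((U⁻¹ : unitary (H →L[ℂ] H)) : H →L[ℂ] H)

theorem unitaryConj_mul (U : unitary (H →L[ℂ] H)) (T R : H →L[ℂ] H) :
    unitaryConj U T * unitaryConj U R = unitaryConj U (T * R) := by
  have h : ((U⁻¹ : unitary (H →L[ℂ] H)) : H →L[ℂ] H) * (U : H →L[ℂ] H) = 1 := by
    rw [← Submonoid.coe_mul, inv_mul_cancel, Submonoid.coe_one]
  simp only [unitaryConj]
  calc _ = (U : H →L[ℂ] H) * T * (((U⁻¹ : unitary (H →L[ℂ] H)) : H →L[ℂ] H) * (U : H →L[ℂ] H)) *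
        R * ((U⁻¹ : unitary (H →L[ℂ] H)) : H →L[ℂ] H) := by simp only [mul_assoc]
    _ = _ := by rw [h, mul_one, mul_assoc (U : H →L[ℂ] H) T R]

theorem isPositive_unitaryConj (U : unitary (H →L[ℂ] H)) {T : H →L[ℂ] H} (hT : T.IsPositive) :
    (unitaryConj U T).IsPositive :=
  hT.conj_adjoint (U : H →L[ℂ] H)

/-- The right-hand side is positive with the correct square, and positive square roots are unique.
-/
theorem sqrt_unitaryConj (U : unitary (H →L[ℂ] H)) {ρ : H →L[ℂ] H} (hρ : ρ.IsPositive) :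
    CFC.sqrt (unitaryConj U ρ) = unitaryConj U (CFC.sqrt ρ) := by
  refine CFC.sqrt_unique ?_ ?_
  · rw [unitaryConj_mul,
      CFC.sqrt_mul_sqrt_self ρ ((ContinuousLinearMap.nonneg_iff_isPositive ρ).mpr hρ)]
  · exact (ContinuousLinearMap.nonneg_iff_isPositive _).mpr (isPositive_unitaryConj U
      ((ContinuousLinearMap.nonneg_iff_isPositive _).mp (CFC.sqrt_nonneg ρ)))

theorem isCompSqrt_idOp_unitaryConj (U : unitary (H →L[ℂ] H))
    {ρ : H →L[ℂ] H} (hρ : ρ.IsPositive) :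
    IsCompSqrt (unitaryConj U ρ) idOp (unitaryConj U (CFC.sqrt ρ)) :=
  by
  rw [← sqrt_unitaryConj U hρ]
  exact isCompSqrt_idOp _

theorem inner_unitary (U : unitary (H →L[ℂ] H)) (x y : H) :
    ⟪(U : H →L[ℂ] H) x, (U : H →L[ℂ] H) y⟫_ℂ = ⟪x, y⟫_ℂ :=
  (Unitary.linearIsometryEquiv U).inner_map_map x y

theorem exists_hilbertBasis_inv (U : unitary (H →L[ℂ] H)) {ι : Type} (e : HilbertBasis ι ℂ H) :
    ∃ f : HilbertBasis ι ℂ H, ∀ i, f i = ((U⁻¹ : unitary (H →L[ℂ] H)) : H →L[ℂ] H) (e i) :=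
  ⟨⟨(Unitary.linearIsometryEquiv U).trans e.repr⟩, fun _ => rfl⟩

/-- Conjugation by U amounts to replacing the basis e by U⁻¹e, and the hypothesis covers every
basis. -/
theorem hasSum_inner_unitaryConj (U : unitary (H →L[ℂ] H)) {T R : H →L[ℂ] H} {t : ℂ}
    (h : ∀ (ι : Type) (e : HilbertBasis ι ℂ H), HasSum (fun i => ⟪T (e i), R (e i)⟫_ℂ) t)
    (ι : Type) (e : HilbertBasis ι ℂ H) :
    HasSum (fun i => ⟪unitaryConj U T (e i), unitaryConj U R (e i)⟫_ℂ) t := by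
  obtain ⟨f, hf⟩ := exists_hilbertBasis_inv U e
  convert h ι f using 2 with i
  rw [hf]
  exact inner_unitary U _ _

theorem IsDensityOperator.unitaryConj {ρ : H →L[ℂ] H} (hρ : IsDensityOperator ρ)
    (U : unitary (H →L[ℂ] H)) : IsDensityOperator (unitaryConj U ρ) := by
  refine ⟨isPositive_unitaryConj U hρ.1, fun ι e => ?_⟩
  obtain ⟨f, hf⟩ := exists_hilbertBasis_inv U e
  convert hρ.2 ι f using 2 with i
  rw [hf]
  exact (ContinuousLinearMap.adjoint_inner_left (U : H →L[ℂ] H) _ _).symm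

end Conjugation

/-! ### Transformation of the variance matrix -/

theorem det_beta_ne_zero (n : ℕ) : (beta n).det ≠ 0 := by
  simp [beta, Matrix.det_kronecker, Matrix.det_fin_two]

theorem isUnit_of_mem_Sp {n : ℕ} {S : Matrix (Idx n) (Idx n) ℝ} (hS : S ∈ Sp n) : IsUnit S := by
  rw [Matrix.isUnit_iff_isUnit_det, isUnit_iff_ne_zero]
  intro h
  have h1 := congrArg Matrix.det (show S * beta n * S.transpose = beta n from hS)
  rw [Matrix.det_mul, Matrix.det_mul, h, zero_mul, zero_mul] at h1
  exact det_beta_ne_zero n h1.symm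

/-- S fixes β under congruence and is real, so the whole matrix V + (iħ/2)β is conjugated by S and
its adjoint; S is invertible, so positivity passes both ways. -/
theorem uncertaintyRelation_congr {n : ℕ} {hbar : ℝ} {S : Matrix (Idx n) (Idx n) ℝ}
    (hS : S ∈ Sp n) (V : Matrix (Idx n) (Idx n) ℂ) :
    UncertaintyRelation hbar V ↔ UncertaintyRelation hbar
      (S.map Complex.ofReal * V * (S.map Complex.ofReal).transpose) := by
  have hU : IsUnit (S.map Complex.ofReal) := (isUnit_of_mem_Sp hS).map Complex.ofRealHom.mapMatrix
  have hstar : star (S.map Complex.ofReal) = (S.map Complex.ofReal).transpose := by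
    ext i j
    simp [Matrix.star_apply]
  have hβ : S.map Complex.ofReal * (beta n).map Complex.ofReal * (S.map Complex.ofReal).transpose =
      (beta n).map Complex.ofReal := by
    have h := congrArg (Complex.ofRealHom.mapMatrix) (show S * beta n * S.transpose = beta n from hS)
    rw [map_mul, map_mul] at h
    exact h
  unfold UncertaintyRelation
  rw [← Matrix.IsUnit.posSemidef_star_right_conjugate_iff hU, hstar, mul_add, add_mul,
    Matrix.mul_smul, Matrix.smul_mul, hβ]

/-- The square root of the new state is U √ρ U⁻¹, and the range of √ρ lies in the common domain,
where the metaplectic relation applies. -/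
theorem IsMetaplectic.isCompSqrt {n : ℕ} {hbar : ℝ} {S : Matrix (Idx n) (Idx n) ℝ}
    {U : unitary (Hilb n →L[ℂ] Hilb n)} (hU : IsMetaplectic hbar S U)
    {ρ : Hilb n →L[ℂ] Hilb n} (hρ : ρ.IsPositive) {T : Idx n → Hilb n →L[ℂ] Hilb n}
    (hT : ∀ b, IsCompSqrt ρ (xi hbar b) (T b)) (a : Idx n) :
    IsCompSqrt (unitaryConj U ρ) (xi hbar a) (unitaryConj U (∑ b, (S a b : ℂ) • T b)) := by
  intro x
  rw [sqrt_unitaryConj U hρ]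
  have hb := fun b => hT b (((U⁻¹ : unitary (Hilb n →L[ℂ] Hilb n)) : Hilb n →L[ℂ] Hilb n) x)
  obtain ⟨ha, he⟩ := hU _ (fun b => (hb b).1) a
  refine ⟨ha, he.trans ?_⟩
  simp only [(hb _).2]
  change _ = (U : Hilb n →L[ℂ] Hilb n) ((∑ b, (S a b : ℂ) • T b)
    (((U⁻¹ : unitary (Hilb n →L[ℂ] Hilb n)) : Hilb n →L[ℂ] Hilb n) x))
  rw [sum_apply]
  rfl

/-- Sesquilinearity of the Hilbert–Schmidt pairing; the entries of S are real, so no conjugates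
appear. The nesting of the sums is that of (S m) Sᵀ. -/
theorem IsMetaplectic.hasMoment {n : ℕ} {hbar : ℝ} {S : Matrix (Idx n) (Idx n) ℝ}
    {U : unitary (Hilb n →L[ℂ] Hilb n)} (hU : IsMetaplectic hbar S U)
    {ρ : Hilb n →L[ℂ] Hilb n} (hρ : ρ.IsPositive) {T : Idx n → Hilb n →L[ℂ] Hilb n}
    (hT : ∀ b, IsCompSqrt ρ (xi hbar b) (T b)) {m : Idx n → Idx n → ℂ}
    (hm : ∀ c d, HasMoment ρ (xi hbar c) (xi hbar d) (m c d)) (a b : Idx n) :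
    HasMoment (unitaryConj U ρ) (xi hbar a) (xi hbar b)
      (∑ d, ∑ c, (S a c : ℂ) * m c d * S b d) := by
  rw [(hU.isCompSqrt hρ hT a).hasMoment_iff (hU.isCompSqrt hρ hT b)]
  refine hasSum_inner_unitaryConj U fun ι e => ?_
  refine (hasSum_sum (s := Finset.univ) fun d _ => hasSum_sum (s := Finset.univ) fun c _ =>
    ((((hT c).hasMoment_iff (hT d) _).mp (hm c d) ι e).mul_left (S a c : ℂ)).mul_right
      (S b d : ℂ)).congr_fun fun i => ?_
  simp only [sum_apply, smul_apply, inner_sum, sum_inner, inner_smul_left, inner_smul_right,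
    Complex.conj_ofReal]
  refine Finset.sum_congr rfl fun d _ => ?_
  rw [Finset.mul_sum]
  exact Finset.sum_congr rfl fun c _ => by ring

theorem IsMetaplectic.hasMoment_idOp {n : ℕ} {hbar : ℝ} {S : Matrix (Idx n) (Idx n) ℝ}
    {U : unitary (Hilb n →L[ℂ] Hilb n)} (hU : IsMetaplectic hbar S U)
    {ρ : Hilb n →L[ℂ] Hilb n} (hρ : ρ.IsPositive) {T : Idx n → Hilb n →L[ℂ] Hilb n}
    (hT : ∀ b, IsCompSqrt ρ (xi hbar b) (T b)) {m : Idx n → ℂ}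
    (hm : ∀ c, HasMoment ρ idOp (xi hbar c) (m c)) (a : Idx n) :
    HasMoment (unitaryConj U ρ) idOp (xi hbar a) (∑ c, (S a c : ℂ) * m c) := by
  rw [(isCompSqrt_idOp_unitaryConj U hρ).hasMoment_iff (hU.isCompSqrt hρ hT a)]
  refine hasSum_inner_unitaryConj U fun ι e => ?_
  refine (hasSum_sum (s := Finset.univ) fun c _ =>
    ((((isCompSqrt_idOp ρ).hasMoment_iff (hT c) _).mp (hm c) ι e).mul_left (S a c : ℂ))).congr_fun
      fun i => ?_
  simp only [sum_apply, smul_apply, inner_sum, inner_smul_right]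

theorem IsMetaplectic.varianceMatrix_conjState {n : ℕ} {hbar : ℝ}
    {S : Matrix (Idx n) (Idx n) ℝ} {U : unitary (Hilb n →L[ℂ] Hilb n)}
    (hU : IsMetaplectic hbar S U) {ρ : Hilb n →L[ℂ] Hilb n} (hρ : IsDensityOperator ρ)
    (h2 : HasFiniteSecondMoments hbar ρ) :
    HasFiniteSecondMoments hbar (conjState U ρ) ∧
      varianceMatrix hbar (conjState U ρ) =
        S.map Complex.ofReal * varianceMatrix hbar ρ * (S.map Complex.ofReal).transpose := by
  choose T hT hHS using fun a => (h2 a).choose_spec.exists_isCompSqrt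
  -- Only diagonal moments are assumed; the mixed ones exist because each ξ_a √ρ is Hilbert–Schmidt.
  choose m hm using fun a b => (hHS a).exists_hasSum_inner (hHS b)
  choose μ hμ using fun b => hρ.isHilbertSchmidt_sqrt.exists_hasSum_inner (hHS b)
  replace hm := fun a b => ((hT a).hasMoment_iff (hT b) _).mpr (hm a b)
  replace hμ := fun b => ((isCompSqrt_idOp ρ).hasMoment_iff (hT b) _).mpr (hμ b)
  have hm' := hU.hasMoment hρ.1 hT hm
  have hμ' := hU.hasMoment_idOp hρ.1 hT hμ
  refine ⟨fun a => ⟨_, hm' a a⟩, ?_⟩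
  ext a b
  change covariance (unitaryConj U ρ) (xi hbar a) (xi hbar b) = _
  rw [covariance, mean, mean, (hm' a b).moment_eq, (hm' b a).moment_eq, (hμ' a).moment_eq,
    (hμ' b).moment_eq, Matrix.mul_apply]
  simp only [Matrix.mul_apply, Matrix.transpose_apply, Matrix.map_apply, varianceMatrix,
    Matrix.of_apply, covariance, mean, (hm _ _).moment_eq, (hμ _).moment_eq, Finset.sum_mul]
  -- In the reversed moment ⟨ξ_b ξ_a⟩ the summation indices play opposite roles; swapping them
  -- aligns it with ⟨ξ_a ξ_b⟩ term by term.
  rw [Finset.sum_comm (f := fun d c => (S b c : ℂ) * m c d * S a d), ← Finset.sum_add_distrib,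
    Finset.sum_div]
  simp only [← Finset.sum_add_distrib, Finset.sum_div, Finset.mul_sum]
  rw [Finset.sum_comm (f := fun c d => (S a c : ℂ) * μ c * (S b d * μ d)),
    ← Finset.sum_sub_distrib]
  simp only [← Finset.sum_sub_distrib]
  exact Finset.sum_congr rfl fun d _ => Finset.sum_congr rfl fun c _ => by ring

end QuantumModes
end

theorem mainTheorem5 (n : ℕ) (hbar : ℝ) (hbar_pos : 0 < hbar)
    (S : Matrix (Fin n × Fin 2) (Fin n × Fin 2) ℝ) (hS : S ∈ QuantumModes.Sp n) :
    (∃ U, QuantumModes.IsMetaplectic hbar S U) ∧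
    ∀ U, QuantumModes.IsMetaplectic hbar S U →
      ∀ ρ, QuantumModes.IsDensityOperator ρ → QuantumModes.HasFiniteSecondMoments hbar ρ →
        QuantumModes.IsDensityOperator (QuantumModes.conjState U ρ) ∧
        QuantumModes.HasFiniteSecondMoments hbar (QuantumModes.conjState U ρ) ∧
        QuantumModes.varianceMatrix hbar (QuantumModes.conjState U ρ) =
          S.map Complex.ofReal * QuantumModes.varianceMatrix hbar ρ *
            (S.map Complex.ofReal).transpose ∧
        (QuantumModes.UncertaintyRelation hbar (QuantumModes.varianceMatrix hbar ρ) ↔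
          QuantumModes.UncertaintyRelation hbar
            (QuantumModes.varianceMatrix hbar (QuantumModes.conjState U ρ))) := by
  refine ⟨QuantumModes.exists_isMetaplectic hbar_pos hS, fun U hU ρ hρ h2 => ?_⟩
  obtain ⟨h3, h4⟩ := hU.varianceMatrix_conjState hρ h2
  refine ⟨hρ.unitaryConj U, h3, h4, ?_⟩
  rw [h4]
  exact QuantumModes.uncertaintyRelation_congr hS _
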